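/- All digraphs are finite; a digraph is a finite (possibly empty) vertex set with an arbitrary set of arcs (ordered pairs of vertices, loops allowed), and $G\to H$ means that there is a homomorphism (arc-preserving map) from $G$ to $H$. Digraphs $H,H'$ are homomorphically equivalent if $H\to H'$ and $H'\to H$. A tree is an orientation of an undirected tree. A set $\mathcal F$ of digraphs is a complete set of obstructions for $H$ if for every digraph $G$ we have $G\to H$ if and only if no $F\in\mathcal F$ satisfies $F\to G$; a dual of a tree $T$ is a digraph for which $\{T\}$ is a complete set of obstructions. The arc graph $\delta G$ of $G=(V,A)$ has vertex set $A$ and arcs $((u,v),(v,w))$ for $(u,v),(v,w)\in A$. Products are products in the category of digraphs: there is an arc from $(x_1,\dots,x_k)$ to $(y_1,\dots,y_k)$ if and only if $(x_i,y_i)$ is an arc of the $i$-th factor for every $i$. A core of $H$ is a smallest subgraph of $H$ to which $H$ admits a homomorphism; a digraph is a core if it is a core of itself, i.e. if it admits no homomorphism to a proper subgraph of itself. A near-unanimity function on $H$ is a homomorphism $f:H^k\to H$ for some $k\ge 3$ such that for all $x,y\in V(H)$, $f(x,x,\dots,x)=f(y,x,\dots,x)=f(x,y,x,\dots,x)=\dots=f(x,\dots,x,y)=x$.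 The algebraic height of a tree $T$ is the minimum number of arcs of a directed path to which $T$ admits a homomorphism; $H$ has bounded-height tree duality if there is a constant $m$ such that $H$ has a complete set of obstructions consisting of trees of algebraic height at most $m$. **Proposition 3.1.** Let $\delta_\pi\mathcal C$ be the smallest class of digraphs that contains all duals of trees and is closed under taking arc graphs, finite products and homomorphically equivalent digraphs. Then: (i) Every core in $\delta_\pi\mathcal C$ admits a near-unanimity function. (ii) Every member of $\delta_\pi\mathcal C$ has bounded-height tree duality. (iii) The class of digraphs that admit a near-unanimity function is closed under taking cores, finite products and arc graphs. (iv) The class of digraphs that have bounded-height tree duality is closed under taking cores, finite products and arc graphs. -/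

import Mathlib

universe u

/-- A finite digraph: a finite vertex set with an arbitrary set of arcs (ordered pairs of vertices).
Loops and the empty digraph are allowed. -/
structure FinDigraph where
  /-- the vertices -/
  V : Type u
  /-- the arcs -/
  graph : Digraph V
  [finite : Finite V]

namespace FinDigraph

attribute [instance] FinDigraph.finite

/-- `G.Adj x y` : the pair `(x, y)` is an arc of `G`. -/
abbrev Adj (G : FinDigraph.{u}) (x y : G.V) : Prop := G.graph.Adj x y

/-- Homomorphisms of digraphs: arc-preserving maps. -/
abbrev Hom (G H : FinDigraph.{u}) : Type u := G.Adj →r H.Adj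

/-- `G → H` : there exists a homomorphism from `G` to `H`. -/
def MapsTo (G H : FinDigraph.{u}) : Prop := Nonempty (Hom G H)

/-- Homomorphic equivalence. -/
def HomEquiv (G H : FinDigraph.{u}) : Prop := G.MapsTo H ∧ H.MapsTo G

/-- The arc graph `δ G`: its vertices are the arcs of `G`, and its arcs are the pairs
`((x, y), (y, z))` of consecutive arcs of `G`. -/
def arcGraph (G : FinDigraph.{u}) : FinDigraph.{u} where
  V := {a : G.V × G.V // G.Adj a.1 a.2}
  graph := { Adj := fun a b => a.1.2 = b.1.1 }

/-- The product `H 0 × ⋯ × H (k - 1)` in the category of digraphs. -/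
def prod {k : ℕ} (H : Fin k → FinDigraph.{u}) : FinDigraph.{u} where
  V := ∀ i, (H i).V
  graph := { Adj := fun x y => ∀ i, (H i).Adj (x i) (y i) }

/-- The `k`-fold power `H × ⋯ × H`. -/
abbrev power (H : FinDigraph.{u}) (k : ℕ) : FinDigraph.{u} := prod (fun _ : Fin k => H)

/-- `H` admits a near-unanimity function: for some `k ≥ 3` there is a homomorphism
`f : H ^ k → H` such that `f (x, …, x, y, x, …, x) = x` for all vertices `x, y` and every position
of `y` (the case `y = x` is `f (x, …, x) = x`). -/
def HasNearUnanimity (H : FinDigraph.{u}) : Prop :=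
  ∃ k : ℕ, 3 ≤ k ∧ ∃ f : Hom (H.power k) H,
    ∀ (x y : H.V) (i : Fin k), f (Function.update (fun _ => x) i y) = x

/-- `T` is an (oriented) tree: its arcs orient the edges of an undirected tree, that is, there are
neither loops nor pairs of opposite arcs, and the underlying undirected graph is a tree
(in particular, it is nonempty). -/
def IsTree (T : FinDigraph.{u}) : Prop :=
  (∀ x y, T.Adj x y → ¬ T.Adj y x) ∧ T.graph.toSimpleGraphInclusive.IsTree

/-- `D` is a dual of `T`: a digraph maps to `D` if and only if `T` does not map to it. -/
def IsDual (T D : FinDigraph.{u}) : Prop :=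
  ∀ G : FinDigraph.{u}, G.MapsTo D ↔ ¬ T.MapsTo G

/-- The directed path with `n` arcs `0 → 1 → ⋯ → n`. -/
def dirPath (n : ℕ) : FinDigraph.{u} where
  V := ULift.{u} (Fin (n + 1))
  graph := { Adj := fun i j => (j.down : ℕ) = i.down + 1 }

/-- The algebraic height: the minimum number of arcs of a directed path to which `T` maps
(`⊤` if there is none, which does not happen for trees). -/
noncomputable def algHeight (T : FinDigraph.{u}) : ℕ∞ :=
  ⨅ (n : ℕ) (_ : T.MapsTo (dirPath n)), (n : ℕ∞)

/-- `F` is a complete set of obstructions for `H`. -/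
def IsCompleteObstructionSet (F : Set FinDigraph.{u}) (H : FinDigraph.{u}) : Prop :=
  ∀ G : FinDigraph.{u}, G.MapsTo H ↔ ∀ T ∈ F, ¬ T.MapsTo G

/-- `H` has bounded-height tree duality. -/
def HasBoundedHeightTreeDuality (H : FinDigraph.{u}) : Prop :=
  ∃ (m : ℕ) (F : Set FinDigraph.{u}),
    (∀ T ∈ F, T.IsTree ∧ T.algHeight ≤ (m : ℕ∞)) ∧ IsCompleteObstructionSet F H

/-- Subgraphs of `H`: a subset of the vertices, together with a subset of the arcs of `H` among
these vertices. -/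
@[ext]
structure Subgraph (H : FinDigraph.{u}) where
  /-- the vertices of the subgraph -/
  verts : Set H.V
  /-- the arcs of the subgraph -/
  arc : H.V → H.V → Prop
  arc_sub : ∀ {x y}, arc x y → H.Adj x y
  fst_mem : ∀ {x y}, arc x y → x ∈ verts
  snd_mem : ∀ {x y}, arc x y → y ∈ verts

/-- A subgraph of `H`, as a digraph on its own. -/
def Subgraph.toFinDigraph {H : FinDigraph.{u}} (S : H.Subgraph) : FinDigraph.{u} where
  V := S.verts
  graph := { Adj := fun x y => S.arc x y }

/-- Inclusion of subgraphs. -/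
instance {H : FinDigraph.{u}} : LE H.Subgraph where
  le S S' := S.verts ⊆ S'.verts ∧ ∀ x y, S.arc x y → S'.arc x y

/-- `H` as a subgraph of itself. -/
instance {H : FinDigraph.{u}} : Top H.Subgraph where
  top := { verts := Set.univ, arc := H.Adj, arc_sub := id, fst_mem := fun _ => trivial,
           snd_mem := fun _ => trivial }

/-- The subgraph `S` is a core of `H`: it is a smallest (inclusion-minimal) subgraph to
which `H` maps. -/
def Subgraph.IsCoreOf {H : FinDigraph.{u}} (S : H.Subgraph) : Prop :=
  Minimal (fun S' : H.Subgraph => H.MapsTo S'.toFinDigraph) S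

/-- `H` is a core: it is a core of itself, that is, it does not map to any proper subgraph. -/
def IsCore (H : FinDigraph.{u}) : Prop := (⊤ : H.Subgraph).IsCoreOf

/-- The class `δ_π C`: the smallest class of digraphs that contains all duals of trees and is closed
under taking arc graphs, finite products and homomorphically equivalent digraphs. -/
inductive DeltaPiC : FinDigraph.{u} → Prop
  | dual {T D : FinDigraph.{u}} : T.IsTree → IsDual T D → DeltaPiC D
  | arcGraph {H : FinDigraph.{u}} : DeltaPiC H → DeltaPiC H.arcGraph
  | prod {k : ℕ} {H : Fin k → FinDigraph.{u}} : (∀ i, DeltaPiC (H i)) → DeltaPiC (prod H)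
  | homEquiv {H H' : FinDigraph.{u}} : DeltaPiC H → HomEquiv H H' → DeltaPiC H'

end FinDigraph

namespace FinDigraph

/-! Near-unanimity passes along a homomorphic equivalence to a core: conjugating by the two maps
leaves an endomorphism on the diagonal, and endomorphisms of a core are invertible. So (i) follows
once every member of the class is shown equivalent to some digraph with a near-unanimity function;
arc graphs and products are handled coordinatewise. For the core `D` of a dual of `T`, identify
near-constant tuples of `D ^ k` with constant ones. Each arc of the quotient is an arc of `D`
outside two coordinates, so for large `k` a map from `T` to the quotient would have a coordinate
mapping `T` to `D`. Hence `T` does not map to the quotient, and by duality the quotient maps to `D`.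

Bounded-height tree duality is rephrased without trees: for some `m`, arc consistency of `G × P_m`
with `H` implies `G → H` (`hasBoundedHeightTreeDuality_iff`). Consistent lists of arcs of `H` split
into lists of tails and heads on the left adjoint of `δ`, at the cost of one level of height, which
settles arc graphs. Duals qualify because a tree has finite height. -/

theorem MapsTo.trans {G H K : FinDigraph.{u}} (h₁ : G.MapsTo H) (h₂ : H.MapsTo K) :
    G.MapsTo K :=
  h₁.elim fun f => h₂.elim fun g => ⟨g.comp f⟩

theorem MapsTo.refl (G : FinDigraph.{u}) : G.MapsTo G := ⟨RelHom.id _⟩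

theorem HomEquiv.symm {G H : FinDigraph.{u}} (h : G.HomEquiv H) : H.HomEquiv G := ⟨h.2, h.1⟩

theorem HomEquiv.trans {G H K : FinDigraph.{u}} (h₁ : G.HomEquiv H) (h₂ : H.HomEquiv K) :
    G.HomEquiv K :=
  ⟨h₁.1.trans h₂.1, h₂.2.trans h₁.2⟩

/-! ### Cores -/

theorem Subgraph.toFinDigraph_mapsTo {H : FinDigraph.{u}} (S : H.Subgraph) :
    S.toFinDigraph.MapsTo H :=
  ⟨⟨Subtype.val, fun h => S.arc_sub h⟩⟩

theorem mapsTo_top {H : FinDigraph.{u}} : H.MapsTo (⊤ : H.Subgraph).toFinDigraph :=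
  ⟨⟨fun x => ⟨x, trivial⟩, fun h => h⟩⟩

theorem Subgraph.IsCoreOf.homEquiv {H : FinDigraph.{u}} {C : H.Subgraph} (hC : C.IsCoreOf) :
    H.HomEquiv C.toFinDigraph :=
  ⟨hC.prop, C.toFinDigraph_mapsTo⟩

/-- The image of a homomorphism, as a subgraph. -/
def Subgraph.range {G H : FinDigraph.{u}} (f : Hom G H) : H.Subgraph where
  verts := Set.range f
  arc x y := ∃ a b, G.Adj a b ∧ f a = x ∧ f b = y
  arc_sub := by rintro _ _ ⟨a, b, h, rfl, rfl⟩; exact f.map_rel h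
  fst_mem := by rintro _ _ ⟨a, b, h, rfl, rfl⟩; exact ⟨a, rfl⟩
  snd_mem := by rintro _ _ ⟨a, b, h, rfl, rfl⟩; exact ⟨b, rfl⟩

theorem Subgraph.mapsTo_range {G H : FinDigraph.{u}} (f : Hom G H) :
    G.MapsTo (Subgraph.range f).toFinDigraph :=
  ⟨⟨fun x => ⟨f x, x, rfl⟩, fun {a b} h => ⟨a, b, h, rfl, rfl⟩⟩⟩

/-- Every endomorphism of a core of a digraph is surjective. -/
theorem Subgraph.IsCoreOf.surjective {H : FinDigraph.{u}} {C : H.Subgraph} (hC : C.IsCoreOf)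
    (f : Hom C.toFinDigraph C.toFinDigraph) : Function.Surjective f := by
  let i : Hom C.toFinDigraph H := ⟨Subtype.val, fun h => C.arc_sub h⟩
  have hle : Subgraph.range (i.comp f) ≤ C := by
    refine ⟨?_, ?_⟩
    · rintro _ ⟨x, rfl⟩
      exact (f x).2
    · rintro _ _ ⟨a, b, h, rfl, rfl⟩
      exact f.map_rel h
  -- The image still receives a map from `H`, so by minimality it is all of `C`.
  have hge := hC.2 (hC.prop.trans (Subgraph.mapsTo_range (i.comp f))) hle
  intro y
  obtain ⟨x, hx⟩ := hge.1 y.2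
  exact ⟨x, Subtype.ext hx⟩

theorem IsCore.surjective {H : FinDigraph.{u}} (hH : H.IsCore) (f : Hom H H) :
    Function.Surjective f := by
  let f' : Hom (⊤ : H.Subgraph).toFinDigraph (⊤ : H.Subgraph).toFinDigraph :=
    ⟨fun x => ⟨f x.1, trivial⟩, fun h => f.map_rel (show H.Adj _ _ from h)⟩
  intro y
  obtain ⟨x, hx⟩ := Subgraph.IsCoreOf.surjective hH f' ⟨y, trivial⟩
  exact ⟨x.1, congrArg Subtype.val hx⟩

theorem Subgraph.IsCoreOf.isCore {H : FinDigraph.{u}} {C : H.Subgraph} (hC : C.IsCoreOf) :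
    C.toFinDigraph.IsCore := by
  refine ⟨mapsTo_top, fun S hS _ => ?_⟩
  let S' : H.Subgraph :=
    { verts := Subtype.val '' S.verts
      arc := fun x y => ∃ a b, S.arc a b ∧ a.1 = x ∧ b.1 = y
      arc_sub := by rintro _ _ ⟨a, b, h, rfl, rfl⟩; exact C.arc_sub (S.arc_sub h)
      fst_mem := by rintro _ _ ⟨a, b, h, rfl, rfl⟩; exact ⟨a, S.fst_mem h, rfl⟩
      snd_mem := by rintro _ _ ⟨a, b, h, rfl, rfl⟩; exact ⟨b, S.snd_mem h, rfl⟩ }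
  have hmap : S.toFinDigraph.MapsTo S'.toFinDigraph :=
    ⟨⟨fun x => ⟨x.1.1, x.1, x.2, rfl⟩, fun {a b} h => ⟨a.1, b.1, h, rfl, rfl⟩⟩⟩
  have hge := hC.2 ((hC.prop.trans hS).trans hmap) (by
    refine ⟨?_, ?_⟩
    · rintro _ ⟨a, _, rfl⟩
      exact a.2
    · rintro _ _ ⟨a, b, h, rfl, rfl⟩
      exact S.arc_sub h)
  refine ⟨fun x _ => ?_, fun x y h => ?_⟩
  · obtain ⟨a, ha, hx⟩ := hge.1 x.2
    rwa [← Subtype.ext hx]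
  · obtain ⟨a, b, hab, hx, hy⟩ := hge.2 _ _ h
    rwa [← Subtype.ext hx, ← Subtype.ext hy]

/-- A surjective self-map of a finite type has an iterate as its
inverse. -/
theorem exists_iterate_leftInverse {α : Type*} [Finite α] {f : α → α}
    (hf : Function.Surjective f) : ∃ n, ∀ x, f^[n] (f x) = x := by
  let e : Equiv.Perm α := Equiv.ofBijective f ⟨Finite.injective_iff_surjective.2 hf, hf⟩
  have hpos := orderOf_pos e
  refine ⟨orderOf e - 1, fun x => ?_⟩
  have h : (e ^ (orderOf e - 1 + 1)) x = x := by
    rw [Nat.sub_add_cancel hpos, pow_orderOf_eq_one]; rfl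
  rw [pow_succ, Equiv.Perm.mul_apply, ← Equiv.Perm.iterate_eq_pow] at h
  exact h

/-- Iterates of an endomorphism. -/
def Hom.iterate {H : FinDigraph.{u}} (f : Hom H H) (n : ℕ) : Hom H H where
  toFun := f^[n]
  map_rel' {a b} h := by
    induction n generalizing a b with
    | zero => exact h
    | succ n ih => exact ih (f.map_rel h)

/-- Every endomorphism of a core has a left inverse. -/
theorem IsCore.exists_leftInverse {H : FinDigraph.{u}} (hH : H.IsCore) (f : Hom H H) :
    ∃ g : Hom H H, ∀ x, g (f x) = x := by
  obtain ⟨n, hn⟩ := exists_iterate_leftInverse (hH.surjective f)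
  exact ⟨Hom.iterate f n, hn⟩

/-! ### Near-unanimity functions -/

/-- Dummy variables raise the arity, so that the factors of a product can share one. -/
theorem HasNearUnanimity.exists_of_le {H : FinDigraph.{u}} (h : H.HasNearUnanimity) :
    ∃ k₀ : ℕ, 3 ≤ k₀ ∧ ∀ k, k₀ ≤ k → ∃ f : Hom (H.power k) H,
      ∀ (x y : H.V) (i : Fin k), f (Function.update (fun _ => x) i y) = x := by
  obtain ⟨k₀, hk₀, f, hf⟩ := h
  refine ⟨k₀, hk₀, fun k hk => ?_⟩
  refine ⟨⟨fun x => f (fun j => x (Fin.castLE hk j)),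
    fun h => f.map_rel fun j => h (Fin.castLE hk j)⟩, fun x y i => ?_⟩
  by_cases hi : ∃ j, Fin.castLE hk j = i
  · obtain ⟨j, rfl⟩ := hi
    refine Eq.trans (congrArg f (funext fun l => ?_)) (hf x y j)
    by_cases hl : l = j
    · subst hl; simp
    · rw [Function.update_of_ne hl, Function.update_of_ne]
      exact fun h => hl (Fin.castLE_injective hk h)
  · refine Eq.trans (congrArg f (funext fun l => ?_)) (hf x x ⟨0, by omega⟩)
    rw [Function.update_eq_self, Function.update_of_ne]
    exact fun h => hi ⟨l, h⟩

theorem IsCore.hasNearUnanimity_of_homEquiv {C H : FinDigraph.{u}} (hC : C.IsCore)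
    (hCH : C.HomEquiv H) (h : H.HasNearUnanimity) : C.HasNearUnanimity := by
  obtain ⟨⟨s⟩, ⟨r⟩⟩ := hCH
  obtain ⟨k, hk, f, hf⟩ := h
  obtain ⟨g, hg⟩ := hC.exists_leftInverse (r.comp s)
  refine ⟨k, hk, ⟨fun x => g (r (f fun i => s (x i))),
    fun h => g.map_rel (r.map_rel (f.map_rel fun i => s.map_rel (h i)))⟩, fun x y i => ?_⟩
  have : (fun j => s (Function.update (fun _ => x) i y j)) =
      Function.update (fun _ => s x) i (s y) := by
    funext j
    by_cases hj : j = i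
    · subst hj; simp
    · simp [hj]
  change g (r (f _)) = x
  rw [this, hf]
  exact hg x

theorem HasNearUnanimity.core {H : FinDigraph.{u}} {C : H.Subgraph} (hC : C.IsCoreOf)
    (h : H.HasNearUnanimity) : C.toFinDigraph.HasNearUnanimity :=
  hC.isCore.hasNearUnanimity_of_homEquiv hC.homEquiv.symm h

theorem HasNearUnanimity.prod {k : ℕ} {H : Fin k → FinDigraph.{u}}
    (h : ∀ i, (H i).HasNearUnanimity) : (FinDigraph.prod H).HasNearUnanimity := by
  choose a _ ha using fun i => (h i).exists_of_le
  -- The `max 3` covers the empty product.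
  let n := max 3 (Finset.univ.sup a)
  choose f hf using fun i => ha i n ((Finset.le_sup (Finset.mem_univ i)).trans (le_max_right _ _))
  refine ⟨n, le_max_left _ _, ⟨fun x i => f i fun j => x j i,
    fun h i => (f i).map_rel fun j => h j i⟩, fun x y j => funext fun i => ?_⟩
  refine Eq.trans (congrArg (f i) (funext fun l => ?_)) (hf i (x i) (y i) j)
  by_cases hl : l = j
  · subst hl; simp
  · simp [hl]

/-- Apply `f` to tails and to heads separately; consecutive tuples of arcs share the middle tuple,
hence its image. -/
theorem HasNearUnanimity.arcGraph {H : FinDigraph.{u}} (h : H.HasNearUnanimity) :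
    H.arcGraph.HasNearUnanimity := by
  obtain ⟨k, hk, f, hf⟩ := h
  refine ⟨k, hk, ⟨fun x => ⟨(f fun i => (x i).1.1, f fun i => (x i).1.2),
    f.map_rel fun i => (x i).2⟩, fun h => congrArg f (funext h)⟩, fun x y i => ?_⟩
  refine Subtype.ext (Prod.ext ?_ ?_)
  · refine Eq.trans (congrArg f (funext fun l => ?_)) (hf x.1.1 y.1.1 i)
    by_cases hl : l = i
    · subst hl; simp
    · simp [hl]
  · refine Eq.trans (congrArg f (funext fun l => ?_)) (hf x.1.2 y.1.2 i)
    by_cases hl : l = i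
    · subst hl; simp
    · simp [hl]

/-! ### Cores of finite duals -/

/-- Every finite digraph has a core. -/
theorem exists_isCoreOf (H : FinDigraph.{u}) : ∃ C : H.Subgraph, C.IsCoreOf := by
  -- Minimising vertices plus arcs gives inclusion-minimality.
  let size : H.Subgraph → ℕ := fun S => S.verts.ncard + {p : H.V × H.V | S.arc p.1 p.2}.ncard
  have hex : ∃ n, ∃ S : H.Subgraph, H.MapsTo S.toFinDigraph ∧ size S = n :=
    ⟨_, ⊤, mapsTo_top, rfl⟩
  classical
  obtain ⟨S, hS, hn⟩ := Nat.find_spec hex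
  refine ⟨S, hS, fun S' hS' hle => ?_⟩
  have hmin : size S ≤ size S' := hn ▸ Nat.find_min' hex ⟨S', hS', rfl⟩
  have hv := Set.ncard_le_ncard hle.1 (Set.toFinite S.verts)
  have hsub : {p : H.V × H.V | S'.arc p.1 p.2} ⊆ {p | S.arc p.1 p.2} := fun p hp => hle.2 _ _ hp
  have ha := Set.ncard_le_ncard hsub (Set.toFinite _)
  have hmin' : S.verts.ncard + {p : H.V × H.V | S.arc p.1 p.2}.ncard ≤
    S'.verts.ncard + {p : H.V × H.V | S'.arc p.1 p.2}.ncard := hmin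
  have h₁ := Set.eq_of_subset_of_ncard_le hle.1 (by omega) (Set.toFinite _)
  have h₂ := Set.eq_of_subset_of_ncard_le hsub (by omega) (Set.toFinite _)
  exact ⟨h₁.ge, fun x y h => h₂.ge (show (x, y) ∈ _ from h)⟩

theorem IsDual.of_homEquiv {T D D' : FinDigraph.{u}} (h : IsDual T D) (hD : D.HomEquiv D') :
    IsDual T D' := fun G =>
  ⟨fun hG => (h G).1 (hG.trans hD.2), fun hG => ((h G).2 hG).trans hD.1⟩

open Classical in
/-- Sends each tuple that is constant up to one coordinate to the constant tuple. -/
noncomputable def majority {α : Type*} (k : ℕ) (x : Fin k → α) : Fin k → α :=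
  if h : ∃ a b i, x = Function.update (fun _ => a) i b then fun _ => h.choose else x

theorem exists_forall_ne_majority_eq {α : Type*} {k : ℕ} (hk : 0 < k) (x : Fin k → α) :
    ∃ i, ∀ j ≠ i, majority k x j = x j := by
  unfold majority
  split_ifs with h
  · obtain ⟨b, i, hx⟩ := h.choose_spec
    refine ⟨i, fun j hj => ?_⟩
    rw [congrFun hx j, Function.update_of_ne hj]
  · exact ⟨⟨0, hk⟩, fun _ _ => rfl⟩

theorem majority_update {α : Type*} {k : ℕ} (hk : 3 ≤ k) (a b : α) (i : Fin k) :
    majority k (Function.update (fun _ => a) i b) = fun _ => a := by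
  have h : ∃ a' b' i', Function.update (fun _ => a) i b = Function.update (fun _ => a') i' b' :=
    ⟨a, b, i, rfl⟩
  rw [majority, dif_pos h]
  funext _
  obtain ⟨b', i', hx⟩ := h.choose_spec
  -- As `k ≥ 3`, some coordinate avoids both exceptional positions, so the chosen constant is `a`.
  obtain ⟨j, hj⟩ : ∃ j : Fin k, j ∉ ({i, i'} : Finset (Fin k)) := by
    by_contra! hall
    have : (Finset.univ : Finset (Fin k)).card ≤ ({i, i'} : Finset (Fin k)).card :=
      Finset.card_le_card fun j _ => hall j
    have h2 := Finset.card_le_two (a := i) (b := i')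
    simp only [Finset.card_univ, Fintype.card_fin] at this
    omega
  simp only [Finset.mem_insert, Finset.mem_singleton, not_or] at hj
  have := congrFun hx j
  rw [Function.update_of_ne hj.1, Function.update_of_ne hj.2] at this
  exact this.symm

/-- The quotient of `D ^ k` identifying near-constant tuples with constant ones. -/
noncomputable def majorityQuotient (D : FinDigraph.{u}) (k : ℕ) : FinDigraph.{u} where
  V := Fin k → D.V
  graph := { Adj := fun a b => ∃ x y, (D.power k).Adj x y ∧ majority k x = a ∧ majority k y = b }

/-- Each arc of `T` spoils at most two coordinates, so some coordinate is spoiled by none and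
projects to a homomorphism. -/
theorem mapsTo_of_mapsTo_majorityQuotient {T D : FinDigraph.{u}} {k : ℕ}
    (hk : 2 * Nat.card (T.V × T.V) < k) (h : T.MapsTo (D.majorityQuotient k)) : T.MapsTo D := by
  obtain ⟨φ⟩ := h
  have key : ∀ p : T.V × T.V, ∃ i i' : Fin k, T.Adj p.1 p.2 →
      ∀ j, j ≠ i → j ≠ i' → D.Adj (φ p.1 j) (φ p.2 j) := by
    intro p
    by_cases hp : T.Adj p.1 p.2
    · obtain ⟨x, y, hxy, hx, hy⟩ := φ.map_rel hp
      obtain ⟨i, hi⟩ := exists_forall_ne_majority_eq (by omega) x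
      obtain ⟨i', hi'⟩ := exists_forall_ne_majority_eq (by omega) y
      refine ⟨i, i', fun _ j hj hj' => ?_⟩
      rw [← hx, ← hy, hi j hj, hi' j hj']
      exact hxy j
    · exact ⟨⟨0, by omega⟩, ⟨0, by omega⟩, fun h => absurd h hp⟩
  choose a b hab using key
  obtain ⟨j, hj⟩ : ∃ j, j ∉ Set.range a ∪ Set.range b := by
    by_contra! hall
    have h1 : (Set.univ : Set (Fin k)).ncard ≤ (Set.range a ∪ Set.range b).ncard :=
      Set.ncard_le_ncard (fun j _ => hall j) (Set.toFinite _)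
    have h2 := Set.ncard_union_le (Set.range a) (Set.range b)
    have h3 : (Set.range a).ncard ≤ Nat.card (T.V × T.V) := by
      rw [← Set.image_univ, ← Set.ncard_univ]; exact Set.ncard_image_le
    have h4 : (Set.range b).ncard ≤ Nat.card (T.V × T.V) := by
      rw [← Set.image_univ, ← Set.ncard_univ]; exact Set.ncard_image_le
    rw [Set.ncard_univ, Nat.card_fin] at h1
    omega
  refine ⟨⟨fun t => φ t j, fun {s t} h => hab (s, t) h j ?_ ?_⟩⟩
  · rintro rfl; exact hj (Or.inl ⟨_, rfl⟩)
  · rintro rfl; exact hj (Or.inr ⟨_, rfl⟩)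

theorem IsCore.hasNearUnanimity_of_isDual {T D : FinDigraph.{u}} (hD : D.IsCore)
    (h : IsDual T D) : D.HasNearUnanimity := by
  let k := 2 * Nat.card (T.V × T.V) + 3
  have hk : 3 ≤ k := Nat.le_add_left _ _
  obtain ⟨f⟩ : (D.majorityQuotient k).MapsTo D := (h _).2 fun hT =>
    (h D).1 (MapsTo.refl D)
      (mapsTo_of_mapsTo_majorityQuotient (by omega : 2 * Nat.card (T.V × T.V) < k) hT)
  have hconst : ∀ x : D.V, majority k (fun _ => x) = fun _ => x := fun x => by
    have := majority_update hk x x ⟨0, by omega⟩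
    rwa [Function.update_eq_self] at this
  -- The diagonal may be mapped by a nontrivial endomorphism `d`; its left inverse `g` restores the
  -- identity.
  let d : Hom D D := ⟨fun x => f fun _ => x, fun {x y} hxy =>
    f.map_rel ⟨fun _ => x, fun _ => y, fun _ => hxy, hconst x, hconst y⟩⟩
  obtain ⟨g, hg⟩ := hD.exists_leftInverse d
  refine ⟨k, hk, ⟨fun x => g (f (majority k x)), fun {x y} hxy =>
    g.map_rel (f.map_rel ⟨x, y, hxy, rfl, rfl⟩)⟩, fun x y i => ?_⟩
  change g (f (majority k _)) = x
  rw [majority_update hk]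
  exact hg x

/-! ### Near-unanimity up to equivalence throughout the class -/

theorem HomEquiv.arcGraph {G H : FinDigraph.{u}} (h : G.HomEquiv H) :
    G.arcGraph.HomEquiv H.arcGraph := by
  have key : ∀ {G H : FinDigraph.{u}}, G.MapsTo H → G.arcGraph.MapsTo H.arcGraph :=
    fun ⟨f⟩ => ⟨⟨fun a => ⟨(f a.1.1, f a.1.2), f.map_rel a.2⟩, fun h => congrArg f h⟩⟩
  exact ⟨key h.1, key h.2⟩

theorem HomEquiv.prod {k : ℕ} {G H : Fin k → FinDigraph.{u}} (h : ∀ i, (G i).HomEquiv (H i)) :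
    (FinDigraph.prod G).HomEquiv (FinDigraph.prod H) := by
  choose f g using h
  exact ⟨⟨⟨fun x i => (f i).some (x i), fun h i => (f i).some.map_rel (h i)⟩⟩,
    ⟨⟨fun x i => (g i).some (x i), fun h i => (g i).some.map_rel (h i)⟩⟩⟩

theorem DeltaPiC.exists_homEquiv_hasNearUnanimity {H : FinDigraph.{u}} (h : H.DeltaPiC) :
    ∃ H' : FinDigraph.{u}, H.HomEquiv H' ∧ H'.HasNearUnanimity := by
  induction h with
  | @dual T D _ hD =>
    obtain ⟨C, hC⟩ := D.exists_isCoreOf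
    exact ⟨_, hC.homEquiv, hC.isCore.hasNearUnanimity_of_isDual (hD.of_homEquiv hC.homEquiv)⟩
  | arcGraph _ ih =>
    obtain ⟨H', h, hn⟩ := ih
    exact ⟨_, h.arcGraph, hn.arcGraph⟩
  | prod _ ih =>
    choose H' h hn using ih
    exact ⟨_, HomEquiv.prod h, HasNearUnanimity.prod hn⟩
  | homEquiv _ he ih =>
    obtain ⟨H', h, hn⟩ := ih
    exact ⟨H', he.symm.trans h, hn⟩

/-! ### Oriented trees -/

/-- Both neighbours are penultimate on the unique path from `r` to `v`. -/
theorem _root_.SimpleGraph.IsTree.eq_of_adj_of_dist {V : Type*} {G : SimpleGraph V}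
    (hG : G.IsTree) {r u v w : V} (hu : G.Adj u v) (hw : G.Adj w v)
    (hdu : G.dist r v = G.dist r u + 1) (hdw : G.dist r v = G.dist r w + 1) : u = w := by
  obtain ⟨p, hp⟩ := (hG.connected r u).exists_walk_length_eq_dist
  obtain ⟨q, hq⟩ := (hG.connected r w).exists_walk_length_eq_dist
  have hp' : (p.concat hu).IsPath :=
    SimpleGraph.Walk.isPath_of_length_eq_dist _ (by rw [SimpleGraph.Walk.length_concat, hp, hdu])
  have hq' : (q.concat hw).IsPath :=
    SimpleGraph.Walk.isPath_of_length_eq_dist _ (by rw [SimpleGraph.Walk.length_concat, hq, hdw])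
  have := congrArg SimpleGraph.Walk.penultimate ((hG.existsUnique_path r v).unique hp' hq')
  simpa using this

theorem IsTree.simpleGraph_adj {T : FinDigraph.{u}} (hT : T.IsTree) {s t : T.V}
    (h : T.Adj s t) : T.graph.toSimpleGraphInclusive.Adj s t :=
  ⟨by rintro rfl; exact hT.1 _ _ h h, Or.inl h⟩

/-- Choices that can be extended along each arc, in both directions, can be made consistently
on a tree. -/
theorem IsTree.exists_section {T : FinDigraph.{u}} (hT : T.IsTree) {Y : Type*} {E : Y → Y → Prop}
    {C : T.V → Set Y} (hne : ∀ t, (C t).Nonempty)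
    (hfwd : ∀ s t, T.Adj s t → ∀ a ∈ C s, ∃ b ∈ C t, E a b)
    (hbwd : ∀ s t, T.Adj s t → ∀ b ∈ C t, ∃ a ∈ C s, E a b) :
    ∃ ψ : T.V → Y, (∀ t, ψ t ∈ C t) ∧ ∀ s t, T.Adj s t → E (ψ s) (ψ t) := by
  classical
  let G := T.graph.toSimpleGraphInclusive
  have hG : G.IsTree := hT.2
  obtain ⟨r⟩ := hG.connected.nonempty
  -- Grow the section over balls around `r`; each new vertex has at most one neighbour in the
  -- previous ball, hence one constraint.
  have key : ∀ n : ℕ, ∃ ψ : T.V → Y, (∀ t, ψ t ∈ C t) ∧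
      ∀ s t, G.dist r s ≤ n → G.dist r t ≤ n → T.Adj s t → E (ψ s) (ψ t) := by
    intro n
    induction n with
    | zero =>
      refine ⟨fun t => (hne t).some, fun t => (hne t).some_mem, fun s t hs ht h => ?_⟩
      have h1 := hG.dist_ne_of_adj r (hT.simpleGraph_adj h)
      omega
    | succ n ih =>
      obtain ⟨ψ, hψC, hψ⟩ := ih
      have ext : ∀ t, ∃ b ∈ C t, G.dist r t = n + 1 →
          (∀ s, G.dist r s ≤ n → T.Adj s t → E (ψ s) b) ∧
          (∀ s, G.dist r s ≤ n → T.Adj t s → E b (ψ s)) := by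
        intro t
        by_cases hex : G.dist r t = n + 1 ∧ ∃ s, G.dist r s ≤ n ∧ G.Adj s t
        · obtain ⟨ht, s, hs, hst⟩ := hex
          have huniq : ∀ s', G.dist r s' ≤ n → G.Adj s' t → s' = s := fun s' hs' hs't => by
            have h1 := hG.dist_eq_dist_add_one_of_adj r hst
            have h2 := hG.dist_eq_dist_add_one_of_adj r hs't
            exact hG.eq_of_adj_of_dist hs't hst (r := r) (by omega) (by omega)
          rcases hst.2 with h | h
          · obtain ⟨b, hb, hE⟩ := hfwd _ _ h _ (hψC s)
            refine ⟨b, hb, fun _ => ⟨fun s' hs' h' => ?_, fun s' hs' h' => ?_⟩⟩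
            · rwa [huniq s' hs' (hT.simpleGraph_adj h')]
            · rw [huniq s' hs' (hT.simpleGraph_adj h').symm] at h'
              exact absurd h' (hT.1 _ _ h)
          · obtain ⟨b, hb, hE⟩ := hbwd _ _ h _ (hψC s)
            refine ⟨b, hb, fun _ => ⟨fun s' hs' h' => ?_, fun s' hs' h' => ?_⟩⟩
            · rw [huniq s' hs' (hT.simpleGraph_adj h')] at h'
              exact absurd h' (hT.1 _ _ h)
            · rwa [huniq s' hs' (hT.simpleGraph_adj h').symm]
        · refine ⟨_, (hne t).some_mem, fun ht => ⟨fun s hs h => ?_, fun s hs h => ?_⟩⟩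
          · exact absurd ⟨ht, s, hs, hT.simpleGraph_adj h⟩ hex
          · exact absurd ⟨ht, s, hs, (hT.simpleGraph_adj h).symm⟩ hex
      choose b hbC hb using ext
      refine ⟨fun t => if G.dist r t = n + 1 then b t else ψ t, fun t => ?_, fun s t hs ht h => ?_⟩
      · dsimp only
        split_ifs
        exacts [hbC t, hψC t]
      · have h1 := hG.dist_ne_of_adj r (hT.simpleGraph_adj h)
        dsimp only
        split_ifs with h2 h3 h3
        · omega
        · exact (hb s h2).2 t (by omega) h
        · exact (hb t h3).1 s (by omega) h
        · exact hψ s t (by omega) (by omega) h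
  obtain ⟨N, hN⟩ := (Set.finite_range (G.dist r)).bddAbove
  obtain ⟨ψ, hC, hψ⟩ := key N
  exact ⟨ψ, hC, fun s t => hψ s t (hN ⟨s, rfl⟩) (hN ⟨t, rfl⟩)⟩

/-! ### Algebraic height -/

theorem dirPath_mapsTo {n m : ℕ} (h : n ≤ m) : (dirPath.{u} n).MapsTo (dirPath m) :=
  ⟨⟨fun i => ⟨Fin.castLE (by omega) i.down⟩, fun h => h⟩⟩

theorem algHeight_le_iff {T : FinDigraph.{u}} {m : ℕ} :
    T.algHeight ≤ m ↔ T.MapsTo (dirPath m) := by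
  refine ⟨fun h => ?_, fun h => iInf₂_le m h⟩
  by_contra hm
  have : ((m + 1 : ℕ) : ℕ∞) ≤ T.algHeight := by
    refine le_iInf₂ fun n hn => ?_
    by_contra! hlt
    exact hm (hn.trans (dirPath_mapsTo (by have := Nat.cast_lt.1 hlt; omega)))
  have := Nat.cast_le.1 (this.trans h)
  omega

theorem IsTree.exists_mapsTo_dirPath {T : FinDigraph.{u}} (hT : T.IsTree) :
    ∃ m : ℕ, T.MapsTo (dirPath m) := by
  -- Integer levels rising by one along each arc; subtracting a lower bound puts them on a path.
  obtain ⟨ψ, -, hψ⟩ := hT.exists_section (E := fun a b : ℤ => b = a + 1)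
    (C := fun _ => Set.univ) (fun _ => ⟨0, trivial⟩) (fun _ _ _ a _ => ⟨a + 1, trivial, rfl⟩)
    (fun _ _ _ b _ => ⟨b - 1, trivial, by omega⟩)
  obtain ⟨A, hA⟩ := (Set.finite_range ψ).bddAbove
  obtain ⟨B, hB⟩ := (Set.finite_range ψ).bddBelow
  have hA' : ∀ t, ψ t ≤ A := fun t => hA ⟨t, rfl⟩
  have hB' : ∀ t, B ≤ ψ t := fun t => hB ⟨t, rfl⟩
  refine ⟨(A - B).toNat, ⟨⟨fun t => ⟨⟨(ψ t - B).toNat, ?_⟩⟩, fun {s t} h => ?_⟩⟩⟩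
  · have := hA' t
    have := hB' t
    omega
  · have := hψ s t h
    have := hB' s
    change (ψ t - B).toNat = (ψ s - B).toNat + 1
    omega

/-- The digraph with one vertex and no arc. -/
def point : FinDigraph.{u} where
  V := PUnit
  graph := { Adj := fun _ _ => False }

theorem isTree_point : point.{u}.IsTree :=
  ⟨fun _ _ h => h.elim, by
    have : Subsingleton point.{u}.V := inferInstanceAs (Subsingleton PUnit)
    have : Nonempty point.{u}.V := inferInstanceAs (Nonempty PUnit)
    exact SimpleGraph.IsTree.of_subsingleton⟩

/-- The disjoint union of `S` and `T` with an additional arc from `s` to `t`. -/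
def join (S T : FinDigraph.{u}) (s : S.V) (t : T.V) : FinDigraph.{u} where
  V := S.V ⊕ T.V
  graph := { Adj := fun
    | .inl a, .inl b => S.Adj a b
    | .inr a, .inr b => T.Adj a b
    | .inl a, .inr b => a = s ∧ b = t
    | .inr _, .inl _ => False }

open SimpleGraph in
theorem _root_.SimpleGraph.IsTree.sum_sup_edge {V W : Type*} [Finite V] [Finite W]
    {G : SimpleGraph V} {H : SimpleGraph W} (hG : G.IsTree) (hH : H.IsTree) (v : V) (w : W) :
    ((G ⊕g H) ⊔ edge (.inl v) (.inr w)).IsTree := by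
  rw [isTree_iff_connected_and_card] at hG hH ⊢
  refine ⟨hG.1.sum_sup_edge hH.1, ?_⟩
  have hset : ((G ⊕g H) ⊔ edge (.inl v) (.inr w)).edgeSet =
      insert s(.inl v, .inr w) (G ⊕g H).edgeSet := by
    rw [edgeSet_sup, edgeSet_edge_of_ne (by simp), Set.union_comm, Set.singleton_union]
  have hcard : Nat.card (G ⊕g H).edgeSet = Nat.card G.edgeSet + Nat.card H.edgeSet := by
    rw [Nat.card_congr edgeSetSumEquiv, Nat.card_sum]
  rw [hset, Nat.card_coe_set_eq, Set.ncard_insert_of_notMem (by simp), ← Nat.card_coe_set_eq,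
    hcard, Nat.card_sum]
  omega

theorem IsTree.join {S T : FinDigraph.{u}} (hS : S.IsTree) (hT : T.IsTree) (s : S.V) (t : T.V) :
    (S.join T s t).IsTree := by
  refine ⟨?_, ?_⟩
  · rintro (a | a) (b | b) h h'
    · exact hS.1 _ _ h h'
    · exact h'
    · exact h
    · exact hT.1 _ _ h h'
  · have h : (S.join T s t).graph.toSimpleGraphInclusive =
        ((S.graph.toSimpleGraphInclusive ⊕g T.graph.toSimpleGraphInclusive) ⊔
          SimpleGraph.edge (.inl s) (.inr t) : SimpleGraph (S.V ⊕ T.V)) := ?_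
    · rw [h]
      exact hS.2.sum_sup_edge hT.2 s t
    refine SimpleGraph.ext (funext fun a => funext fun b => propext ?_)
    rcases a with a | a <;> rcases b with b | b
    · change ((Sum.inl a : S.V ⊕ T.V) ≠ .inl b ∧ (S.graph.Adj a b ∨ S.graph.Adj b a)) ↔ _
      simp [Digraph.toSimpleGraphInclusive, SimpleGraph.edge_adj]
    · change ((Sum.inl a : S.V ⊕ T.V) ≠ .inr b ∧ (a = s ∧ b = t ∨ False)) ↔ _
      simp [SimpleGraph.edge_adj]
    · change ((Sum.inr a : S.V ⊕ T.V) ≠ .inl b ∧ (False ∨ b = s ∧ a = t)) ↔ _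
      simp [SimpleGraph.edge_adj, and_comm]
    · change ((Sum.inr a : S.V ⊕ T.V) ≠ .inr b ∧ (T.graph.Adj a b ∨ T.graph.Adj b a)) ↔ _
      simp [Digraph.toSimpleGraphInclusive, SimpleGraph.edge_adj]

/-! ### Arc consistency -/

/-- There is a nonempty arc-consistent system of lists of vertices of `H` on `X`. -/
def ArcConsistent (X H : FinDigraph.{u}) : Prop :=
  ∃ g : X.V → Set H.V, (∀ x, (g x).Nonempty) ∧ ∀ x y, X.Adj x y →
    (∀ a ∈ g x, ∃ b ∈ g y, H.Adj a b) ∧ (∀ b ∈ g y, ∃ a ∈ g x, H.Adj a b)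

theorem ArcConsistent.mapsTo_of_isTree {T X H : FinDigraph.{u}} (h : X.ArcConsistent H)
    (hT : T.IsTree) (hTX : T.MapsTo X) : T.MapsTo H := by
  obtain ⟨g, hne, hg⟩ := h
  obtain ⟨φ⟩ := hTX
  obtain ⟨ψ, -, hψ⟩ := hT.exists_section (E := H.Adj) (C := fun t => g (φ t)) (fun t => hne _)
    (fun s t h => (hg _ _ (φ.map_rel h)).1) (fun s t h => (hg _ _ (φ.map_rel h)).2)
  exact ⟨⟨ψ, fun h => hψ _ _ h⟩⟩

/-- Some tree over `X` forces the image in `H` of a vertex over `x` to belong to `A`. -/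
def Forces (X H : FinDigraph.{u}) (x : X.V) (A : Set H.V) : Prop :=
  ∃ (T : FinDigraph.{u}) (r : T.V) (φ : Hom T X), T.IsTree ∧ φ r = x ∧ ∀ ψ : Hom T H, ψ r ∈ A

/-- Take as list at `x` a minimal forced set. Joining the trees for `x` and `y` by an arc forces the
subset of values with a partner in the other list, so minimality makes the lists consistent. -/
theorem arcConsistent_of_forall_isTree {X H : FinDigraph.{u}}
    (h : ∀ T : FinDigraph.{u}, T.IsTree → T.MapsTo X → T.MapsTo H) : X.ArcConsistent H := by
  have hmin : ∀ x, ∃ A, Minimal (X.Forces H x) A := fun x => by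
    obtain ⟨A, -, hA⟩ := (Set.toFinite {A | X.Forces H x A}).exists_le_minimal
      (a := Set.univ) ⟨point, ⟨⟩, ⟨fun _ => x, fun h => h.elim⟩, isTree_point, rfl,
        fun _ => trivial⟩
    exact ⟨A, hA⟩
  choose g hg using hmin
  refine ⟨g, fun x => ?_, fun x y hxy => ⟨fun a ha => ?_, fun b hb => ?_⟩⟩
  · obtain ⟨T, r, φ, hT, -, hr⟩ := (hg x).prop
    obtain ⟨ψ⟩ := h T hT ⟨φ⟩
    exact ⟨ψ r, hr ψ⟩
  all_goals
    obtain ⟨S, s, φ, hS, hs, hsA⟩ := (hg x).prop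
    obtain ⟨T, t, χ, hT, ht, htA⟩ := (hg y).prop
    let φχ : Hom (S.join T s t) X := ⟨Sum.elim φ χ, by
      rintro (a | a) (b | b) hab
      · exact φ.map_rel hab
      · obtain ⟨rfl, rfl⟩ := hab
        change X.Adj (φ a) (χ b)
        rwa [hs, ht]
      · exact hab.elim
      · exact χ.map_rel hab⟩
    have hl : ∀ ψ : Hom (S.join T s t) H, ψ (.inl s) ∈ g x := fun ψ =>
      hsA ⟨fun a => ψ (.inl a), fun h => ψ.map_rel (a := Sum.inl _) (b := Sum.inl _) h⟩
    have hr : ∀ ψ : Hom (S.join T s t) H, ψ (.inr t) ∈ g y := fun ψ =>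
      htA ⟨fun a => ψ (.inr a), fun h => ψ.map_rel (a := Sum.inr _) (b := Sum.inr _) h⟩
    have hm : ∀ ψ : Hom (S.join T s t) H, H.Adj (ψ (.inl s)) (ψ (.inr t)) := fun ψ =>
      ψ.map_rel (a := Sum.inl _) (b := Sum.inr _) ⟨rfl, rfl⟩
  · have : X.Forces H x {a ∈ g x | ∃ b ∈ g y, H.Adj a b} :=
      ⟨S.join T s t, Sum.inl s, φχ, hS.join hT s t, hs, fun ψ => ⟨hl ψ, _, hr ψ, hm ψ⟩⟩
    exact ((hg x).2 this (fun _ h => h.1) ha).2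
  · have : X.Forces H y {b ∈ g y | ∃ a ∈ g x, H.Adj a b} :=
      ⟨S.join T s t, Sum.inr t, φχ, hS.join hT s t, ht, fun ψ => ⟨hr ψ, _, hl ψ, hm ψ⟩⟩
    exact ((hg y).2 this (fun _ h => h.1) hb).2

/-- The product of `G` with the directed path with `m` arcs. -/
def prodPath (G : FinDigraph.{u}) (m : ℕ) : FinDigraph.{u} where
  V := G.V × Fin (m + 1)
  graph := { Adj := fun p q => G.Adj p.1 q.1 ∧ (q.2 : ℕ) = p.2 + 1 }

theorem mapsTo_prodPath_iff {T G : FinDigraph.{u}} {m : ℕ} :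
    T.MapsTo (G.prodPath m) ↔ T.MapsTo G ∧ T.MapsTo (dirPath m) :=
  ⟨fun ⟨f⟩ => ⟨⟨⟨fun t => (f t).1, fun h => (f.map_rel h).1⟩⟩,
      ⟨⟨fun t => ⟨(f t).2⟩, fun h => (f.map_rel h).2⟩⟩⟩,
    fun ⟨⟨f⟩, ⟨g⟩⟩ => ⟨⟨fun t => (f t, (g t).down), fun h => ⟨f.map_rel h, g.map_rel h⟩⟩⟩⟩

theorem hasBoundedHeightTreeDuality_iff {H : FinDigraph.{u}} :
    H.HasBoundedHeightTreeDuality ↔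
      ∃ m : ℕ, ∀ G : FinDigraph.{u}, (G.prodPath m).ArcConsistent H → G.MapsTo H := by
  constructor
  · rintro ⟨m, F, hF, hFH⟩
    refine ⟨m, fun G hG => (hFH G).2 fun T hT hTG => ?_⟩
    have hTP := mapsTo_prodPath_iff.2 ⟨hTG, algHeight_le_iff.1 (hF T hT).2⟩
    exact (hFH H).1 (MapsTo.refl H) T hT (hG.mapsTo_of_isTree (hF T hT).1 hTP)
  · rintro ⟨m, hm⟩
    -- The largest candidate: all trees of height at most `m` that do not map to `H`.
    refine ⟨m, {T | (T.IsTree ∧ T.algHeight ≤ m) ∧ ¬ T.MapsTo H}, fun T hT => hT.1, fun G => ?_⟩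
    refine ⟨fun hG T hT hTG => hT.2 (hTG.trans hG), fun hG => hm G ?_⟩
    refine arcConsistent_of_forall_isTree fun T hT hTX => ?_
    obtain ⟨hTG, hTm⟩ := mapsTo_prodPath_iff.1 hTX
    by_contra hTH
    exact hG T ⟨⟨hT, algHeight_le_iff.2 hTm⟩, hTH⟩ hTG

/-! ### Closure properties of bounded-height tree duality -/

theorem HasBoundedHeightTreeDuality.of_homEquiv {H H' : FinDigraph.{u}} (he : H.HomEquiv H')
    (h : H.HasBoundedHeightTreeDuality) : H'.HasBoundedHeightTreeDuality := by
  obtain ⟨m, F, hF, hFH⟩ := h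
  exact ⟨m, F, hF, fun G => ⟨fun hG => (hFH G).1 (hG.trans he.2),
    fun hG => ((hFH G).2 hG).trans he.1⟩⟩

theorem HasBoundedHeightTreeDuality.prod {k : ℕ} {H : Fin k → FinDigraph.{u}}
    (h : ∀ i, (H i).HasBoundedHeightTreeDuality) :
    (FinDigraph.prod H).HasBoundedHeightTreeDuality := by
  choose m F hF hFH using h
  refine ⟨Finset.univ.sup m, ⋃ i, F i, fun T hT => ?_, fun G => ⟨?_, fun hG => ?_⟩⟩
  · obtain ⟨i, hi⟩ := Set.mem_iUnion.1 hT
    exact ⟨(hF i T hi).1, (hF i T hi).2.trans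
      (Nat.cast_le.2 (Finset.le_sup (f := m) (Finset.mem_univ i)))⟩
  · rintro ⟨f⟩ T hT
    obtain ⟨i, hi⟩ := Set.mem_iUnion.1 hT
    exact (hFH i G).1 ⟨⟨fun x => f x i, fun h => f.map_rel h i⟩⟩ T hi
  · have f : ∀ i, G.MapsTo (H i) := fun i => (hFH i G).2 fun T hT => hG T (Set.mem_iUnion.2 ⟨i, hT⟩)
    exact ⟨⟨fun x i => (f i).some x, fun h i => (f i).some.map_rel h⟩⟩

/-- The left adjoint of the arc graph construction: each vertex `u` becomes an arc from
`(u, false)` to `(u, true)`, and `(u, true)` is identified with `(v, false)` for each arc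
`(u, v)`. -/
def arcGraphLeftAdjoint (G : FinDigraph.{u}) : FinDigraph.{u} where
  V := Quot fun p q : G.V × Bool => G.Adj p.1 q.1 ∧ p.2 = true ∧ q.2 = false
  graph := { Adj := fun c d => ∃ u, c = Quot.mk _ (u, false) ∧ d = Quot.mk _ (u, true) }

theorem mapsTo_arcGraph_of_leftAdjoint {G H : FinDigraph.{u}}
    (h : G.arcGraphLeftAdjoint.MapsTo H) : G.MapsTo H.arcGraph := by
  obtain ⟨f⟩ := h
  exact ⟨⟨fun u => ⟨(f (Quot.mk _ (u, false)), f (Quot.mk _ (u, true))),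
    f.map_rel ⟨u, rfl, rfl⟩⟩, fun h => congrArg f (Quot.sound ⟨h, rfl, rfl⟩)⟩⟩

/-- At level `j`, `(u, true)` gets the heads of the list at `(u, j)` and `(u, false)` the tails of
the list at `(u, j + 1)`. Consistency makes this respect the identifications, and the two ends of an
arc of the left adjoint then read the same list. -/
theorem ArcConsistent.leftAdjoint {G H : FinDigraph.{u}} {m : ℕ}
    (h : (G.prodPath (m + 1)).ArcConsistent H.arcGraph) :
    (G.arcGraphLeftAdjoint.prodPath m).ArcConsistent H := by
  obtain ⟨g, hne, hg⟩ := h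
  let src (u : G.V) (j : Fin (m + 2)) : Set H.V := (fun a => a.1.1) '' g (u, j)
  let tgt (u : G.V) (j : Fin (m + 2)) : Set H.V := (fun a => a.1.2) '' g (u, j)
  have hst : ∀ u v (j : Fin (m + 1)), G.Adj u v → tgt u j.castSucc = src v j.succ := by
    intro u v j huv
    obtain ⟨h₁, h₂⟩ := hg (u, j.castSucc) (v, j.succ) ⟨huv, by simp⟩
    ext z
    constructor
    · rintro ⟨a, ha, rfl⟩
      obtain ⟨b, hb, hab⟩ := h₁ a ha
      exact ⟨b, hb, hab.symm⟩
    · rintro ⟨b, hb, rfl⟩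
      obtain ⟨a, ha, hab⟩ := h₂ b hb
      exact ⟨a, ha, hab⟩
  let L (j : Fin (m + 1)) : G.arcGraphLeftAdjoint.V → Set H.V :=
    Quot.lift (fun p => if p.2 then tgt p.1 j.castSucc else src p.1 j.succ) (by
      rintro ⟨u, _⟩ ⟨v, _⟩ ⟨huv, rfl, rfl⟩
      simpa using hst u v j huv)
  refine ⟨fun p => L p.2 p.1, ?_, ?_⟩
  · rintro ⟨⟨u, (_ | _)⟩, j⟩
    · exact (hne (u, j.succ)).image _
    · exact (hne (u, j.castSucc)).image _
  · rintro ⟨_, i⟩ ⟨_, j⟩ ⟨⟨u, rfl, rfl⟩, hij⟩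
    have hij : i.succ = j.castSucc := Fin.ext (by simpa using hij.symm)
    change (∀ a ∈ src u i.succ, ∃ b ∈ tgt u j.castSucc, H.Adj a b) ∧
      ∀ b ∈ tgt u j.castSucc, ∃ a ∈ src u i.succ, H.Adj a b
    rw [hij]
    refine ⟨?_, ?_⟩
    · rintro _ ⟨a, ha, rfl⟩
      exact ⟨_, ⟨a, ha, rfl⟩, a.2⟩
    · rintro _ ⟨a, ha, rfl⟩
      exact ⟨_, ⟨a, ha, rfl⟩, a.2⟩

theorem HasBoundedHeightTreeDuality.arcGraph {H : FinDigraph.{u}}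
    (h : H.HasBoundedHeightTreeDuality) : H.arcGraph.HasBoundedHeightTreeDuality := by
  rw [hasBoundedHeightTreeDuality_iff] at h ⊢
  obtain ⟨m, hm⟩ := h
  exact ⟨m + 1, fun G hG => mapsTo_arcGraph_of_leftAdjoint (hm _ hG.leftAdjoint)⟩

theorem DeltaPiC.hasBoundedHeightTreeDuality {H : FinDigraph.{u}} (h : H.DeltaPiC) :
    H.HasBoundedHeightTreeDuality := by
  induction h with
  | @dual T D hT hD =>
    obtain ⟨m, hm⟩ := hT.exists_mapsTo_dirPath
    refine ⟨m, {T}, ?_, fun G => ?_⟩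
    · rintro _ rfl
      exact ⟨hT, algHeight_le_iff.2 hm⟩
    · simpa using hD G
  | arcGraph _ ih => exact ih.arcGraph
  | prod _ ih => exact HasBoundedHeightTreeDuality.prod ih
  | homEquiv _ he ih => exact ih.of_homEquiv he

end FinDigraph

theorem proposition3p1 :
    -- (i)
    (∀ H : FinDigraph.{u}, H.DeltaPiC → H.IsCore → H.HasNearUnanimity) ∧
    -- (ii)
    (∀ H : FinDigraph.{u}, H.DeltaPiC → H.HasBoundedHeightTreeDuality) ∧
    -- (iii) near-unanimity functions are preserved by cores, finite products and arc graphs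
    ((∀ (H : FinDigraph.{u}) (C : H.Subgraph), C.IsCoreOf → H.HasNearUnanimity →
        C.toFinDigraph.HasNearUnanimity) ∧
      (∀ (k : ℕ) (H : Fin k → FinDigraph.{u}), (∀ i, (H i).HasNearUnanimity) →
        (FinDigraph.prod H).HasNearUnanimity) ∧
      (∀ H : FinDigraph.{u}, H.HasNearUnanimity → H.arcGraph.HasNearUnanimity)) ∧
    -- (iv) bounded-height tree duality is preserved by cores, finite products and arc graphs
    ((∀ (H : FinDigraph.{u}) (C : H.Subgraph), C.IsCoreOf → H.HasBoundedHeightTreeDuality →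
        C.toFinDigraph.HasBoundedHeightTreeDuality) ∧
      (∀ (k : ℕ) (H : Fin k → FinDigraph.{u}), (∀ i, (H i).HasBoundedHeightTreeDuality) →
        (FinDigraph.prod H).HasBoundedHeightTreeDuality) ∧
      (∀ H : FinDigraph.{u}, H.HasBoundedHeightTreeDuality →
        H.arcGraph.HasBoundedHeightTreeDuality)) := by
  open FinDigraph in
  refine ⟨fun H hH hc => ?_, fun H => DeltaPiC.hasBoundedHeightTreeDuality,
    ⟨fun _ _ hC => HasNearUnanimity.core hC, fun _ _ => HasNearUnanimity.prod,
      fun _ => HasNearUnanimity.arcGraph⟩,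
    fun _ _ hC => HasBoundedHeightTreeDuality.of_homEquiv hC.homEquiv,
    fun _ _ => HasBoundedHeightTreeDuality.prod, fun _ => HasBoundedHeightTreeDuality.arcGraph⟩
  obtain ⟨H', he, hn⟩ := hH.exists_homEquiv_hasNearUnanimity
  exact hc.hasNearUnanimity_of_homEquiv he hn
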